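/- Let $k$ be an algebraically closed field and let $\mathcal C$ be a $k$-linear abelian braided monoidal category with bilinear tensor product which is semi-rigid, i.e. every object has finite length, the unit $\mathbb 1$ is simple, and $\mathcal C$ is an r-category: for every $X\in\mathcal C$ the functor $Z\mapsto \operatorname{Hom}(Z\otimes X,\mathbb 1)$ is representable by an object $X^*$, and the resulting contravariant functor $X\mapsto X^*$ is an equivalence $\mathcal C^{\mathrm{op}}\to\mathcal C$. Assume that $\mathcal C$ has moderate growth: for every indecomposable $X\in\mathcal C$ there is $n\in\mathbb N$ with $\dim_k\operatorname{End}(X^{\otimes n})<n!$ (in particular, this dimension is finite). Let $\operatorname{Irr}(\mathcal C)$ be the set of isomorphism classes of simple objects, and let $S\subset\operatorname{Irr}(\mathcal C)$ be a subset consisting of non-negligible objects, where an indecomposable object $X$ is called non-negligible if $\mathbb 1$ is a direct summand of $Y\otimes X$ for some $Y\in\mathcal C$. Suppose that $\operatorname{Irr}(\mathcal C)$ has a recursive filtration relative to $S$: an increasing exhaustive filtration by subsets $\operatorname{Irr}_n(\mathcal C)$, $n\ge 0$, such that, with $\operatorname{Irr}_{-1}(\mathcal C)=\emptyset$, for every $n\ge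 0$ and every $X\in\operatorname{Irr}_n(\mathcal C)$ there exist $m\ge 0$ and objects $X_1,\dots,X_m\in\mathcal C$, all of whose composition factors lie in $S$, such that the composition series of $X_1\otimes\cdots\otimes X_m$ (which is $\mathbb 1$ if $m=0$) consists of a single copy of $X$ and elements of $\operatorname{Irr}_{n-1}(\mathcal C)$. Then $\mathcal C$ is rigid, i.e. every object of $\mathcal C$ has a left dual and a right dual. -/

import Mathlib

open CategoryTheory CategoryTheory.Limits CategoryTheory.MonoidalCategory

namespace BraidedRigidity

universe w v u

section Tensor

variable {C : Type u} [Category.{v} C] [MonoidalCategory C]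

/-- The tensor product of a finite list of objects; the empty tensor product is the unit. -/
def tensorList : List C → C
  | [] => 𝟙_ C
  | X :: Xs => X ⊗ tensorList Xs

/-- The tensor power of an object. -/
def tensorPow (X : C) (n : ℕ) : C :=
  tensorList (List.replicate n X)

end Tensor

section RCategory

variable (C : Type u) [Category.{v} C] [MonoidalCategory C]

/-- The structure of an r-category: for each `X` the functor `Z ↦ Hom(Z ⊗ X, 𝟙)` is represented by
an object `dual X`, and the resulting contravariant functor `dual` is an equivalence of categories.
The action of `dual` on morphisms is the one that is forced by `homEquiv_naturality_right`. -/
structure RDuality where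
  /-- The duality functor. -/
  dual : Cᵒᵖ ⥤ C
  /-- The bijection which exhibits `dual X` as a representing object. -/
  homEquiv (Z X : C) : (Z ⊗ X ⟶ 𝟙_ C) ≃ (Z ⟶ dual.obj (Opposite.op X))
  homEquiv_naturality_left {Z' Z : C} (h : Z' ⟶ Z) (X : C) (g : Z ⊗ X ⟶ 𝟙_ C) :
    homEquiv Z' X (h ▷ X ≫ g) = h ≫ homEquiv Z X g
  homEquiv_naturality_right (Z : C) {X X' : C} (f : X ⟶ X') (g : Z ⊗ X' ⟶ 𝟙_ C) :
    homEquiv Z X (Z ◁ f ≫ g) = homEquiv Z X' g ≫ dual.map f.op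
  isEquivalence : dual.IsEquivalence

/-- A monoidal category is an r-category. -/
def IsRCategory : Prop :=
  Nonempty (RDuality C)

end RCategory

section CompositionSeries

variable (C : Type u) [Category.{v} C] [Abelian C]

/-- Isomorphism of simple objects. -/
def simpleSetoid : Setoid {X : C // Simple X} where
  r X Y := Nonempty (X.1 ≅ Y.1)
  iseqv :=
    { refl := fun X => ⟨Iso.refl X.1⟩
      symm := fun ⟨e⟩ => ⟨e.symm⟩
      trans := fun ⟨e⟩ ⟨f⟩ => ⟨e.trans f⟩ }

/-- The set of isomorphism classes of simple objects. -/
def Irr : Type u :=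
  Quotient (simpleSetoid C)

variable {C}

/-- The class of a simple object. -/
def Irr.mk (X : C) [hX : Simple X] : Irr C :=
  Quotient.mk (simpleSetoid C) ⟨X, hX⟩

/-- `HasCompositionSeries X m`: the object `X` has a finite filtration whose successive quotients
are simple, and `m` is the multiset of the isomorphism classes of these quotients. -/
inductive HasCompositionSeries : C → Multiset (Irr C) → Prop
  | zero (X : C) (hX : IsZero X) : HasCompositionSeries X 0
  | extend (E : ShortComplex C) (hE : E.ShortExact) [Simple E.X₃] (m : Multiset (Irr C))
      (h : HasCompositionSeries E.X₁ m) : HasCompositionSeries E.X₂ (Irr.mk E.X₃ ::ₘ m)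

/-- An object of finite length. -/
def HasFiniteLength (X : C) : Prop :=
  ∃ m : Multiset (Irr C), HasCompositionSeries X m

end CompositionSeries

section Linear

variable (k : Type w) [Field k] (C : Type u) [Category.{v} C] [Abelian C] [MonoidalCategory C]

/-- A semi-rigid category: an abelian r-category in which every object has finite length and the
unit is simple. (Linearity over a field and bilinearity of the tensor product are expressed by
`Linear`, `MonoidalPreadditive` and `MonoidalLinear`.) -/
structure IsSemiRigid : Prop where
  isRCategory : IsRCategory C
  finiteLength (X : C) : HasFiniteLength X
  simple_unit : Simple (𝟙_ C)

variable {C}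

/-- An object `X` has moderate growth if `dim End(X^{⊗n}) < n!` for some `n`. The dimension is a
cardinal, so that the inequality includes finite-dimensionality. -/
def ModerateGrowthObj [Linear k C] (X : C) : Prop :=
  ∃ n : ℕ, Module.rank k (tensorPow X n ⟶ tensorPow X n) < (n.factorial : Cardinal)

variable (C) in
/-- A category has moderate growth if all its indecomposable objects do. -/
def ModerateGrowth [Linear k C] : Prop :=
  ∀ X : C, Indecomposable X → ModerateGrowthObj k X

/-- An indecomposable object `X` is non-negligible if the unit is a direct summand of `Y ⊗ X` for
some `Y`. -/
def NonNegligible (X : C) : Prop :=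
  Indecomposable X ∧ ∃ Y Z : C, Nonempty (Y ⊗ X ≅ 𝟙_ C ⊞ Z)

/-- The step before `n` of a filtration indexed by the natural numbers; the step before `0` is
empty. -/
def prevStep (F : ℕ → Set (Irr C)) : ℕ → Set (Irr C)
  | 0 => ∅
  | n + 1 => F n

/-- `F` is a recursive filtration on `Irr C` relative to `S`: it is increasing and exhaustive, and
each simple object `X` in the `n`-th step occurs exactly once in the composition series of some
tensor product `X₁ ⊗ ⋯ ⊗ Xₘ` (`m ≥ 0`) of objects with composition factors in `S`, the other
composition factors lying in the previous step. -/
structure IsRecursiveFiltration (S : Set (Irr C)) (F : ℕ → Set (Irr C)) : Prop where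
  increasing : Monotone F
  exhaustive (x : Irr C) : ∃ n, x ∈ F n
  recursive (n : ℕ) (x : Irr C) (hx : x ∈ F n) :
    ∃ Xs : List C,
      (∀ Y ∈ Xs, ∃ m : Multiset (Irr C), HasCompositionSeries Y m ∧ ∀ s ∈ m, s ∈ S) ∧
      ∃ m : Multiset (Irr C),
        HasCompositionSeries (tensorList Xs) (x ::ₘ m) ∧ ∀ y ∈ m, y ∈ prevStep F n

end Linear

end BraidedRigidity

/-!
## Rigidity of braided categories which are generated by non-negligible simple objects

Let `D X = X*` denote the duality of the r-category, with its universal pairing `X* ⊗ X ⟶ 𝟙`.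

*Simple objects in `S`.* Let `X` be simple and `i : 𝟙 ⟶ Y ⊗ X`, `p : Y ⊗ X ⟶ 𝟙` with `i ≫ p = 𝟙`.
By means of `i` and `p` one can close the first strand of a morphism `X ⊗ A ⟶ X ⊗ B`, which gives a
morphism `A ⟶ B` (`partialClosure`). The closure of the crossing `β_ X X` is an endomorphism of `X`,
namely the zigzag of `i ≫ (β_ X Y).inv` and `p` (`zigzag_eq_partialClosure`). By Schur's lemma it is
invertible or zero. If it is invertible, then `X` is rigid, since the second triangle identity comes
for free in an r-category (`RDuality.exists_exactPairing_of_isIso`). If it is zero, consider the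
braids `strandShift l` on `n + 1` strands which carry the first strand to position `l`. Partial
closures show that `∑ (X ⊗ uₗ) ≫ strandShift l` determines the endomorphisms `u₀, …, uₙ` of
`X^{⊗n}` (`shiftSum_injective`), so that `dim End (X^{⊗(n+1)}) ≥ (n + 1) dim End (X^{⊗n})` and
`dim End (X^{⊗n}) ≥ n!` for all `n`, in contradiction to moderate growth.

*Two out of three.* An object `X` is rigid if and only if the canonical morphism
`mu : W* ⊗ X* ⟶ (X ⊗ W)*` is invertible for all `W`. It is natural in `X`, so if two terms of a
short exact sequence are rigid, then so is the third by the five lemma, once the rows are known to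
be exact. The functor `D` is exact and the tensor product is right exact, having adjoints. What
remains is that a short exact sequence with rigid third term stays exact after tensoring with any
object (`mono_whiskerRight_of_shortExact`).

*Conclusion.* In a composition series of a rigid object in which all simple factors but one are
rigid, the remaining factor is rigid (`RDuality.mem_rigidClasses_of_compositionSeries`). By induction
along the filtration all simple objects are rigid, hence so are all objects of finite length. In a
braided category a right dual is also a left dual.
-/

namespace BraidedRigidity

universe w v u

/-! ### Morphisms of short exact sequences -/

section ShortExactRows

variable {C : Type u} [Category.{v} C] [Abelian C] {S₁ S₂ : ShortComplex C}

lemma isIso₁_of_shortExact_of_isIso₂₃ (φ : S₁ ⟶ S₂) (h₁ : S₁.ShortExact) (h₂ : S₂.ShortExact)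
    (i₂ : IsIso φ.τ₂) (i₃ : IsIso φ.τ₃) : IsIso φ.τ₁ := by
  have := h₁.mono_f
  have := h₂.mono_f
  have w : (S₂.f ≫ inv φ.τ₂) ≫ S₁.g = 0 := by
    rw [← cancel_mono φ.τ₃, Category.assoc, Category.assoc, ← φ.comm₂₃, IsIso.inv_hom_id_assoc,
      S₂.zero, zero_comp]
  refine ⟨h₁.exact.lift _ w, ?_, ?_⟩
  · rw [← cancel_mono S₁.f, Category.assoc, h₁.exact.lift_f, φ.comm₁₂_assoc, IsIso.hom_inv_id,
      Category.comp_id, Category.id_comp]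
  · rw [← cancel_mono S₂.f, Category.assoc, φ.comm₁₂, h₁.exact.lift_f_assoc, Category.assoc,
      IsIso.inv_hom_id, Category.comp_id, Category.id_comp]

lemma isIso₃_of_shortExact_of_isIso₁₂ (φ : S₁ ⟶ S₂) (h₁ : S₁.ShortExact) (h₂ : S₂.ShortExact)
    (i₁ : IsIso φ.τ₁) (i₂ : IsIso φ.τ₂) : IsIso φ.τ₃ := by
  have := h₁.epi_g
  have := h₂.epi_g
  have w : S₂.f ≫ inv φ.τ₂ ≫ S₁.g = 0 := by
    rw [← cancel_epi φ.τ₁, φ.comm₁₂_assoc, IsIso.hom_inv_id_assoc, S₁.zero, comp_zero]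
  refine ⟨h₂.exact.desc _ w, ?_, ?_⟩
  · rw [← cancel_epi S₁.g, ← φ.comm₂₃_assoc, h₂.exact.g_desc, IsIso.hom_inv_id_assoc,
      Category.comp_id]
  · rw [← cancel_epi S₂.g, h₂.exact.g_desc_assoc, Category.assoc, ← φ.comm₂₃,
      IsIso.inv_hom_id_assoc, Category.comp_id]

end ShortExactRows

/-! ### The duality of an r-category and the canonical morphism `W* ⊗ X* ⟶ (X ⊗ W)*` -/

namespace RDuality

variable {C : Type u} [Category.{v} C] [MonoidalCategory C]

variable (d : RDuality C)

/-- The dual `X*` of an object of an r-category. -/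
abbrev D (X : C) : C := d.dual.obj (Opposite.op X)

/-- The transpose `Y* ⟶ X*` of a morphism `X ⟶ Y`. -/
abbrev Dmap {X Y : C} (f : X ⟶ Y) : d.D Y ⟶ d.D X := d.dual.map f.op

/-- The universal pairing `X* ⊗ X ⟶ 𝟙`. -/
def ev (X : C) : d.D X ⊗ X ⟶ 𝟙_ C := (d.homEquiv (d.D X) X).symm (𝟙 _)

lemma homEquiv_ev (X : C) : d.homEquiv _ X (d.ev X) = 𝟙 _ := by simp [ev]

lemma homEquiv_whisker_ev {Z X : C} (h : Z ⟶ d.D X) : d.homEquiv Z X (h ▷ X ≫ d.ev X) = h := by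
  rw [d.homEquiv_naturality_left, homEquiv_ev, Category.comp_id]

lemma whisker_homEquiv_ev {Z X : C} (g : Z ⊗ X ⟶ 𝟙_ C) : d.homEquiv Z X g ▷ X ≫ d.ev X = g :=
  (d.homEquiv Z X).injective (d.homEquiv_whisker_ev _)

lemma hom_ext {Z X : C} {h h' : Z ⟶ d.D X} (w : h ▷ X ≫ d.ev X = h' ▷ X ≫ d.ev X) : h = h' := by
  rw [← d.homEquiv_whisker_ev h, w, d.homEquiv_whisker_ev]

lemma Dmap_ev {X Y : C} (f : X ⟶ Y) : d.Dmap f ▷ X ≫ d.ev X = d.D Y ◁ f ≫ d.ev Y := by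
  apply (d.homEquiv _ _).injective
  rw [d.homEquiv_whisker_ev, d.homEquiv_naturality_right, d.homEquiv_ev, Category.id_comp]

lemma exists_D_iso (Y : C) : ∃ W : C, Nonempty (d.D W ≅ Y) := by
  have := d.isEquivalence
  exact ⟨_, ⟨d.dual.objObjPreimageIso Y⟩⟩

/-- `Z ↦ Z ⊗ X` has the right adjoint `Y = W* ↦ (X ⊗ W)*`, because every object is a dual. -/
lemma isLeftAdjoint_tensorRight (d : RDuality C) (X : C) : (tensorRight X).IsLeftAdjoint := by
  choose W e using d.exists_D_iso
  refine (Adjunction.adjunctionOfEquivRight (F := tensorRight X) (G_obj := fun Y => d.D (X ⊗ W Y))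
    (fun Z Y => (Iso.homToEquiv (e Y).some.symm).trans <| (d.homEquiv (Z ⊗ X) (W Y)).symm.trans <|
      (Iso.homFromEquiv (α_ Z X (W Y))).trans (d.homEquiv Z _)) ?_).isLeftAdjoint
  intro Z' Z Y f g
  apply d.hom_ext
  simp only [Equiv.trans_apply, whisker_homEquiv_ev, Iso.homFromEquiv_apply, Iso.homToEquiv_apply,
    comp_whiskerRight, Category.assoc]
  rw [Iso.inv_comp_eq]
  apply (d.homEquiv _ _).injective
  simp [d.homEquiv_naturality_left]

/-- If a zigzag `X ⟶ X ⊗ Y ⊗ X ⟶ X` is invertible, then `X*` is a right dual of `X`, with the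
universal pairing as evaluation. Rescaling gives one triangle identity; it implies the other one by
the uniqueness in the universal property of `X*`. -/
lemma exists_exactPairing_of_isIso (d : RDuality C) {X Y : C} (c : 𝟙_ C ⟶ X ⊗ Y) (p : Y ⊗ X ⟶ 𝟙_ C)
    (h : IsIso (c ▷ X ≫ (α_ X Y X).hom ≫ X ◁ p)) :
    ∃ _ : ExactPairing X (d.D X), ε_ X (d.D X) = d.ev X := by
  obtain ⟨z, hz⟩ : ∃ z : X ⟶ X, c ▷ X ≫ (α_ X Y X).hom ≫ X ◁ p =
      (λ_ X).hom ≫ z ≫ (ρ_ X).inv :=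
    ⟨(λ_ X).inv ≫ (c ▷ X ≫ (α_ X Y X).hom ≫ X ◁ p) ≫ (ρ_ X).hom, by simp⟩
  have : IsIso z := by
    rw [hz] at h
    exact (isIso_comp_right_iff _ (ρ_ X).inv).1 ((isIso_comp_left_iff (λ_ X).hom _).1 h)
  let c' : 𝟙_ C ⟶ X ⊗ d.D X := c ≫ inv z ▷ Y ≫ X ◁ d.homEquiv _ _ p
  have h₁ : c' ▷ X ≫ (α_ X (d.D X) X).hom ≫ X ◁ d.ev X = (λ_ X).hom ≫ (ρ_ X).inv := by
    calc
      _ = c ▷ X ≫ (inv z ▷ Y) ▷ X ≫ (α_ X Y X).hom ≫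
          X ◁ (d.homEquiv _ _ p ▷ X ≫ d.ev X) := by simp [c']
      _ = (c ▷ X ≫ (α_ X Y X).hom ≫ X ◁ p) ≫ inv z ▷ 𝟙_ C := by
        rw [whisker_homEquiv_ev, associator_naturality_left_assoc, ← whisker_exchange]
        simp
      _ = _ := by
        rw [hz]; simp
  suffices h₂ : d.D X ◁ c' ≫ (α_ _ _ _).inv ≫ d.ev X ▷ d.D X = (ρ_ _).hom ≫ (λ_ _).inv from
    ⟨⟨c', d.ev X, h₂, h₁⟩, rfl⟩
  rw [← cancel_mono (λ_ (d.D X)).hom, ← cancel_epi (ρ_ (d.D X)).inv]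
  apply d.hom_ext
  calc
    _ = (ρ_ (d.D X)).inv ▷ X ≫ (d.D X ◁ c') ▷ X ⊗≫
          (d.ev X ▷ (d.D X ⊗ X) ≫ 𝟙_ C ◁ d.ev X) ⊗≫ 𝟙 _ := by monoidal
    _ = 𝟙 _ ⊗≫ d.D X ◁ (c' ▷ X ≫ (α_ X (d.D X) X).hom ≫ X ◁ d.ev X) ⊗≫ d.ev X ⊗≫ 𝟙 _ := by
      rw [← whisker_exchange]; monoidal
    _ = _ := by
      rw [h₁]; monoidal

lemma nonempty_hasRightDual_of_isIso (d : RDuality C) {X Y : C} (c : 𝟙_ C ⟶ X ⊗ Y)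
    (p : Y ⊗ X ⟶ 𝟙_ C) (h : IsIso (c ▷ X ≫ (α_ X Y X).hom ≫ X ◁ p)) :
    Nonempty (HasRightDual X) := by
  obtain ⟨E, -⟩ := d.exists_exactPairing_of_isIso c p h
  exact ⟨{ rightDual := d.D X }⟩

lemma exists_exactPairing (d : RDuality C) (X : C) [HasRightDual X] :
    ∃ _ : ExactPairing X (d.D X), ε_ X (d.D X) = d.ev X := by
  refine d.exists_exactPairing_of_isIso (η_ X Xᘁ) (ε_ X Xᘁ) ?_
  rw [ExactPairing.evaluation_coevaluation]
  infer_instance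

/-- The canonical morphism `W* ⊗ X* ⟶ (X ⊗ W)*`. -/
def mu (X W : C) : d.D W ⊗ d.D X ⟶ d.D (X ⊗ W) :=
  d.homEquiv _ _ (𝟙 _ ⊗≫ d.D W ◁ d.ev X ▷ W ⊗≫ d.ev W)

lemma mu_ev (X W : C) :
    d.mu X W ▷ (X ⊗ W) ≫ d.ev (X ⊗ W) = 𝟙 _ ⊗≫ d.D W ◁ d.ev X ▷ W ⊗≫ d.ev W :=
  d.whisker_homEquiv_ev _

lemma mu_naturality {X X' : C} (f : X ⟶ X') (W : C) :
    d.D W ◁ d.Dmap f ≫ d.mu X W = d.mu X' W ≫ d.Dmap (f ▷ W) := by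
  apply d.hom_ext
  calc
    _ = 𝟙 _ ⊗≫ d.D W ◁ (d.Dmap f ▷ X ≫ d.ev X) ▷ W ⊗≫ d.ev W := by
      rw [comp_whiskerRight, Category.assoc, mu_ev]; monoidal
    _ = (d.D W ⊗ d.D X') ◁ f ▷ W ⊗≫ d.D W ◁ d.ev X' ▷ W ⊗≫ d.ev W := by
      rw [Dmap_ev]; monoidal
    _ = _ := by
      rw [comp_whiskerRight, Category.assoc, Dmap_ev, ← whisker_exchange_assoc, mu_ev]; monoidal

lemma isIso_mu (X W : C) [HasRightDual X] : IsIso (d.mu X W) := by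
  obtain ⟨E, hE⟩ := d.exists_exactPairing X
  -- the inverse of `mu` is `ν`, built from the coevaluation and the transpose `κ` of the evaluation
  let κ : d.D (X ⊗ W) ⊗ X ⟶ d.D W := d.homEquiv _ _ ((α_ _ _ _).hom ≫ d.ev (X ⊗ W))
  have hκ : κ ▷ W ≫ d.ev W = (α_ _ _ _).hom ≫ d.ev (X ⊗ W) := d.whisker_homEquiv_ev _
  let ν : d.D (X ⊗ W) ⟶ d.D W ⊗ d.D X :=
    (ρ_ _).inv ≫ d.D (X ⊗ W) ◁ η_ X (d.D X) ≫ (α_ _ _ _).inv ≫ κ ▷ d.D X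
  have hν : ν ≫ d.mu X W = 𝟙 _ := by
    apply d.hom_ext
    rw [comp_whiskerRight, Category.assoc, mu_ev, ← hE]
    calc
      _ = 𝟙 _ ⊗≫ d.D (X ⊗ W) ◁ η_ X (d.D X) ▷ (X ⊗ W) ⊗≫
          (κ ▷ (d.D X ⊗ X) ≫ d.D W ◁ ε_ X (d.D X)) ▷ W ⊗≫ d.ev W := by
        simp only [ν]; monoidal
      _ = 𝟙 _ ⊗≫ d.D (X ⊗ W) ◁ (η_ X (d.D X) ▷ X ⊗≫ X ◁ ε_ X (d.D X)) ▷ W ⊗≫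
          (κ ▷ W ≫ d.ev W) := by
        rw [← whisker_exchange]; monoidal
      _ = _ := by
        rw [ExactPairing.evaluation_coevaluation'', hκ]; monoidal
  have : Mono (d.mu X W) := by
    refine ⟨fun {Z} h h' w => ?_⟩
    have recover (g : Z ⟶ d.D W ⊗ d.D X) : g = 𝟙 _ ⊗≫ Z ◁ η_ X (d.D X) ⊗≫
        (g ▷ X ⊗≫ d.D W ◁ d.ev X ≫ (ρ_ _).hom) ▷ d.D X := by
      calc
        _ = g ⊗≫ d.D W ◁ (d.D X ◁ η_ X (d.D X) ⊗≫ ε_ X (d.D X) ▷ d.D X) ⊗≫ 𝟙 _ := by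
          rw [ExactPairing.coevaluation_evaluation'']; monoidal
        _ = 𝟙 _ ⊗≫ (g ▷ 𝟙_ C ≫ (d.D W ⊗ d.D X) ◁ η_ X (d.D X)) ⊗≫ d.D W ◁ d.ev X ▷ d.D X ⊗≫
            𝟙 _ := by
          rw [hE]; monoidal
        _ = _ := by
          rw [← whisker_exchange]; monoidal
    have expand (g : Z ⟶ d.D W ⊗ d.D X) :
        (g ▷ X ⊗≫ d.D W ◁ d.ev X ≫ (ρ_ _).hom) ▷ W ≫ d.ev W =
          (α_ _ _ _).hom ≫ (g ≫ d.mu X W) ▷ (X ⊗ W) ≫ d.ev (X ⊗ W) := by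
      rw [comp_whiskerRight, Category.assoc, mu_ev]
      monoidal
    have key : h ▷ X ⊗≫ d.D W ◁ d.ev X ≫ (ρ_ _).hom =
        h' ▷ X ⊗≫ d.D W ◁ d.ev X ≫ (ρ_ _).hom :=
      d.hom_ext (by rw [expand, expand, w])
    rw [recover h, key, ← recover h']
  have : IsSplitEpi (d.mu X W) := ⟨⟨ν, hν⟩⟩
  exact isIso_of_mono_of_isSplitEpi _

/-- If `W* ≅ X`, the preimage of the canonical map `𝟙 ⟶ (X ⊗ W)*` under `mu` is a
coevaluation for `X`. -/
lemma nonempty_hasRightDual_of_isIso_mu (X : C) (h : ∀ W, IsIso (d.mu X W)) :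
    Nonempty (HasRightDual X) := by
  obtain ⟨W, ⟨e⟩⟩ := d.exists_D_iso X
  -- the coevaluation, with `D W` in the place of `X`
  obtain ⟨c, hcμ⟩ : ∃ c : 𝟙_ C ⟶ d.D W ⊗ d.D X, c ≫ d.mu X W =
      d.homEquiv _ _ ((λ_ _).hom ≫ e.inv ▷ W ≫ d.ev W) :=
    ⟨d.homEquiv _ _ ((λ_ _).hom ≫ e.inv ▷ W ≫ d.ev W) ≫ inv (d.mu X W), by simp⟩
  have hc : c ▷ (X ⊗ W) ⊗≫ d.D W ◁ d.ev X ▷ W ⊗≫ d.ev W = (λ_ _).hom ≫ e.inv ▷ W ≫ d.ev W := by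
    rw [← d.whisker_homEquiv_ev ((λ_ _).hom ≫ e.inv ▷ W ≫ d.ev W), ← hcμ,
      comp_whiskerRight, Category.assoc, mu_ev]
    simp [monoidalComp]
  have hz : c ▷ X ≫ (α_ (d.D W) (d.D X) X).hom ≫ d.D W ◁ d.ev X =
      (λ_ _).hom ≫ e.inv ≫ (ρ_ _).inv := by
    rw [← cancel_mono (ρ_ _).hom]
    apply d.hom_ext
    calc
      _ = (α_ _ _ _).hom ≫ c ▷ (X ⊗ W) ⊗≫ d.D W ◁ d.ev X ▷ W ⊗≫ d.ev W := by monoidal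
      _ = _ := by rw [hc]; simp
  refine d.nonempty_hasRightDual_of_isIso (c ≫ e.hom ▷ _) (d.ev X) ?_
  have : (c ≫ e.hom ▷ _) ▷ X ≫ (α_ _ _ X).hom ≫ X ◁ d.ev X =
      (λ_ _).hom ≫ (ρ_ _).inv := by
    rw [comp_whiskerRight, Category.assoc, associator_naturality_left_assoc, ← whisker_exchange]
    rw [reassoc_of% hz]
    simp
  rw [this]
  infer_instance

end RDuality

/-! ### Flatness of rigid objects -/

section Flatness

variable {C : Type u} [Category.{v} C] [Abelian C] [MonoidalCategory C] [MonoidalPreadditive C]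

/-- A short exact sequence `0 ⟶ P ⟶ Q ⟶ A ⟶ 0` with rigid `A` stays exact on the left after
tensoring with any object `W`, if tensor products preserve epimorphisms. For `A = 𝟙` the reason is
that `a ⊗ b ↦ q(a) b - q(b) a` maps `Q ⊗ Q` to `P` and restricts to `q ⊗ P` on `Q ⊗ P`. Hence, if
`K` is the kernel of `P ⊗ W ⟶ Q ⊗ W`, then `Q ⊗ K ⟶ K ⟶ P ⊗ W` is zero, and `K = 0` because
`q ⊗ K` is an epimorphism. The pullback `E` below plays the role of the first factor `Q` in
general. -/
lemma mono_whiskerRight_of_shortExact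
    (hr : ∀ {Y Z : C} (f : Y ⟶ Z) (X : C), Epi f → Epi (f ▷ X))
    {P Q A : C} {j : P ⟶ Q} {q : Q ⟶ A} {hjq : j ≫ q = 0}
    (hS : (ShortComplex.mk j q hjq).ShortExact) [HasRightDual A] (W : C) : Mono (j ▷ W) := by
  let A' : C := Aᘁ
  have : Mono j := hS.mono_f
  have : Epi q := hS.epi_g
  have : Epi (q ▷ A') := hr q A' inferInstance
  -- `E` is the part of `Q ⊗ A'` over the coevaluation; `s` maps `e ⊗ b` to `ε(e) b - e · q(b)`,
  -- where `Q ⊗ A'` acts by the evaluation of `A'` on `A`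
  let E := pullback (q ▷ A') (η_ A A')
  let a : E ⟶ Q ⊗ A' := pullback.fst _ _
  let ε : E ⟶ 𝟙_ C := pullback.snd _ _
  have haε : a ≫ q ▷ A' = ε ≫ η_ A A' := pullback.condition
  have : Epi ε := inferInstanceAs (Epi (pullback.snd (q ▷ A') (η_ A A')))
  let s' : E ⊗ Q ⟶ Q := ε ▷ Q ≫ (λ_ Q).hom -
    a ▷ Q ≫ (α_ _ _ _).hom ≫ Q ◁ (A' ◁ q ≫ ε_ A A') ≫ (ρ_ Q).hom
  have hs' : s' ≫ q = 0 := by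
    simp only [s', Preadditive.sub_comp, sub_eq_zero]
    calc
      _ = E ◁ q ≫ ε ▷ A ≫ (η_ A A' ▷ A ⊗≫ A ◁ ε_ A A') ⊗≫ 𝟙 _ := by
        rw [ExactPairing.evaluation_coevaluation'', whisker_exchange_assoc]
        simp only [Category.assoc, ← leftUnitor_naturality]
        monoidal
      _ = E ◁ q ≫ (ε ≫ η_ A A') ▷ A ⊗≫ A ◁ ε_ A A' ⊗≫ 𝟙 _ := by monoidal
      _ = (E ◁ q ≫ a ▷ A) ⊗≫ (q ▷ (A' ⊗ A) ≫ A ◁ ε_ A A') ⊗≫ 𝟙 _ := by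
        rw [← haε]; monoidal
      _ = _ := by
        rw [whisker_exchange a q, ← whisker_exchange q (ε_ A A')]; monoidal
  let s : E ⊗ Q ⟶ P := hS.exact.lift s' hs'
  have hs : s ≫ j = s' := hS.exact.lift_f s' hs'
  have hjs : E ◁ j ≫ s = ε ▷ P ≫ (λ_ P).hom := by
    rw [← cancel_mono j, Category.assoc, hs]
    have h0 : E ◁ j ≫ a ▷ Q ≫ (α_ _ _ _).hom ≫ Q ◁ (A' ◁ q ≫ ε_ A A') ≫ (ρ_ Q).hom = 0 := by
      rw [whisker_exchange_assoc]
      calc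
        _ = a ▷ P ≫ (α_ _ _ _).hom ≫ Q ◁ (A' ◁ (j ≫ q) ≫ ε_ A A') ≫ (ρ_ Q).hom := by monoidal
        _ = 0 := by rw [hjq]; simp
    simp only [s', Preadditive.comp_sub, h0, sub_zero]
    rw [whisker_exchange_assoc]
    simp
  refine Preadditive.mono_of_cancel_zero _ fun {K} g hg => ?_
  have : Epi (ε ▷ K ≫ (λ_ K).hom) := by
    have := hr ε K inferInstance
    infer_instance
  rw [← cancel_epi (ε ▷ K ≫ (λ_ K).hom), comp_zero]
  calc
    _ = (ε ▷ K ≫ 𝟙_ C ◁ g) ⊗≫ 𝟙 _ := by monoidal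
    _ = E ◁ g ≫ (α_ _ _ _).inv ≫ (ε ▷ P ≫ (λ_ P).hom) ▷ W := by
      rw [← whisker_exchange]; monoidal
    _ = E ◁ (g ≫ j ▷ W) ≫ (α_ _ _ _).inv ≫ s ▷ W := by
      rw [← hjs]; monoidal
    _ = 0 := by rw [hg]; simp

end Flatness

/-! ### Rigidity in short exact sequences -/

namespace RDuality

section

variable {C : Type u} [Category.{v} C] [MonoidalCategory C]

lemma isLeftAdjoint_tensorLeft [BraidedCategory C] (d : RDuality C) (X : C) :
    (tensorLeft X).IsLeftAdjoint := by
  have := d.isLeftAdjoint_tensorRight X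
  exact Functor.isLeftAdjoint_of_iso (BraidedCategory.tensorLeftIsoTensorRight X).symm

lemma hasRightDual_D [BraidedCategory C] (d : RDuality C) (X : C) [HasRightDual X] :
    Nonempty (HasRightDual (d.D X)) := by
  obtain ⟨E, -⟩ := d.exists_exactPairing X
  have := BraidedCategory.exactPairing_swap X (d.D X)
  exact ⟨{ rightDual := X }⟩

variable [Abelian C]

lemma preservesZeroMorphisms (d : RDuality C) : d.dual.PreservesZeroMorphisms :=
  have := d.isEquivalence
  Functor.preservesZeroMorphisms_of_isLeftAdjoint _

/-- The short complex `X₃* ⟶ X₂* ⟶ X₁*` of a short complex. -/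
abbrev dualComplex (d : RDuality C) (S : ShortComplex C) : ShortComplex C :=
  have := d.preservesZeroMorphisms
  S.op.map d.dual

lemma shortExact_dualComplex (d : RDuality C) {S : ShortComplex C} (hS : S.ShortExact) :
    (d.dualComplex S).ShortExact := by
  have := d.isEquivalence
  have := d.preservesZeroMorphisms
  exact hS.op.map_of_exact d.dual

end

variable {C : Type u} [Category.{v} C] [Abelian C] [MonoidalCategory C] [MonoidalPreadditive C]

lemma shortExact_tensorRight (d : RDuality C) {S : ShortComplex C} (hS : S.ShortExact)
    [HasRightDual S.X₃] (W : C) : (S.map (tensorRight W)).ShortExact := by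
  have hr {Y Z : C} (f : Y ⟶ Z) (X : C) (_ : Epi f) : Epi (f ▷ X) := by
    have := d.isLeftAdjoint_tensorRight X
    exact inferInstanceAs (Epi ((tensorRight X).map f))
  have := d.isLeftAdjoint_tensorRight W
  have := hS.epi_g
  have : PreservesColimitsOfSize.{0, 0} (tensorRight W) :=
    (Adjunction.ofIsLeftAdjoint (tensorRight W)).leftAdjoint_preservesColimits
  exact .mk' (hS.exact.map_of_epi_of_preservesCokernel _ inferInstance inferInstance)
    (mono_whiskerRight_of_shortExact hr hS W) (hr S.g W inferInstance)

variable [BraidedCategory C]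

lemma shortExact_tensorLeft (d : RDuality C) {S : ShortComplex C} (hS : S.ShortExact)
    [HasRightDual S.X₃] (W : C) : (S.map (tensorLeft W)).ShortExact :=
  ShortComplex.shortExact_of_iso
    (S.mapNatIso (BraidedCategory.tensorLeftIsoTensorRight W)).symm (d.shortExact_tensorRight hS W)

/-- The morphism of short complexes which consists of the canonical morphisms `mu`. -/
def muHom (d : RDuality C) (S : ShortComplex C) (W : C) :
    (d.dualComplex S).map (tensorLeft (d.D W)) ⟶ d.dualComplex (S.map (tensorRight W)) where
  τ₁ := d.mu S.X₃ W
  τ₂ := d.mu S.X₂ W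
  τ₃ := d.mu S.X₁ W
  comm₁₂ := (d.mu_naturality S.g W).symm
  comm₂₃ := (d.mu_naturality S.f W).symm

/-- An extension of rigid objects is rigid. -/
lemma hasRightDual_X₂ (d : RDuality C) {S : ShortComplex C} (hS : S.ShortExact)
    [HasRightDual S.X₁] [HasRightDual S.X₃] : Nonempty (HasRightDual S.X₂) := by
  refine d.nonempty_hasRightDual_of_isIso_mu _ fun W => ?_
  have : HasRightDual (d.dualComplex S).X₃ := (d.hasRightDual_D S.X₁).some
  exact ShortComplex.isIso₂_of_shortExact_of_isIso₁₃' (d.muHom S W)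
    (d.shortExact_tensorLeft (d.shortExact_dualComplex hS) _)
    (d.shortExact_dualComplex (d.shortExact_tensorRight hS W)) (d.isIso_mu _ _) (d.isIso_mu _ _)

/-- The kernel of an epimorphism of rigid objects is rigid. -/
lemma hasRightDual_X₁ (d : RDuality C) {S : ShortComplex C} (hS : S.ShortExact)
    [HasRightDual S.X₂] [HasRightDual S.X₃] : Nonempty (HasRightDual S.X₁) := by
  refine d.nonempty_hasRightDual_of_isIso_mu _ fun W => ?_
  have h₂ := d.shortExact_dualComplex (d.shortExact_tensorRight hS W)
  have i₁ : IsIso (d.muHom S W).τ₁ := d.isIso_mu _ _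
  have i₂ : IsIso (d.muHom S W).τ₂ := d.isIso_mu _ _
  -- only the injectivity on the left in the upper row is not formal, and it is inherited
  -- from the lower row
  have h₁ : ((d.dualComplex S).map (tensorLeft (d.D W))).ShortExact := by
    have := d.isLeftAdjoint_tensorLeft (d.D W)
    have := (d.shortExact_dualComplex hS).epi_g
    have := h₂.mono_f
    have : PreservesColimitsOfSize.{0, 0} (tensorLeft (d.D W)) :=
      (Adjunction.ofIsLeftAdjoint _).leftAdjoint_preservesColimits
    refine .mk' ((d.shortExact_dualComplex hS).exact.map_of_epi_of_preservesCokernel _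
      inferInstance inferInstance) ?_
      (inferInstanceAs (Epi ((tensorLeft (d.D W)).map (d.dualComplex S).g)))
    have := mono_comp (d.muHom S W).τ₁ (d.dualComplex (S.map (tensorRight W))).f
    rw [(d.muHom S W).comm₁₂] at this
    exact mono_of_mono _ (d.muHom S W).τ₂
  exact isIso₃_of_shortExact_of_isIso₁₂ (d.muHom S W) h₁ h₂ i₁ i₂

/-- The cokernel of a monomorphism of rigid objects is rigid. -/
lemma hasRightDual_X₃ (d : RDuality C) {S : ShortComplex C} (hS : S.ShortExact)
    [HasRightDual S.X₁] [HasRightDual S.X₂] : Nonempty (HasRightDual S.X₃) := by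
  refine d.nonempty_hasRightDual_of_isIso_mu _ fun W => ?_
  have : HasRightDual (d.dualComplex S).X₃ := (d.hasRightDual_D S.X₁).some
  have h₁ := d.shortExact_tensorLeft (d.shortExact_dualComplex hS) (d.D W)
  have i₂ : IsIso (d.muHom S W).τ₂ := d.isIso_mu _ _
  have i₃ : IsIso (d.muHom S W).τ₃ := d.isIso_mu _ _
  -- only the surjectivity on the right in the lower row is not formal, and it is inherited
  -- from the upper row
  have h₂ : (d.dualComplex (S.map (tensorRight W))).ShortExact := by
    have := d.isEquivalence
    have := d.preservesZeroMorphisms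
    have := d.isLeftAdjoint_tensorRight W
    have : PreservesColimitsOfSize.{0, 0} (tensorRight W) :=
      (Adjunction.ofIsLeftAdjoint _).leftAdjoint_preservesColimits
    have := hS.epi_g
    have := h₁.epi_g
    have e : (S.map (tensorRight W)).Exact :=
      hS.exact.map_of_epi_of_preservesCokernel _ inferInstance inferInstance
    have : Epi (S.map (tensorRight W)).g := inferInstanceAs (Epi ((tensorRight W).map S.g))
    have : Mono (S.map (tensorRight W)).op.f := inferInstanceAs (Mono (S.map (tensorRight W)).g.op)
    refine .mk' (e.op.map_of_mono_of_preservesKernel d.dual inferInstance inferInstance)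
      (inferInstanceAs (Mono (d.dual.map (S.map (tensorRight W)).op.f))) ?_
    have := epi_comp ((d.dualComplex S).map (tensorLeft (d.D W))).g (d.muHom S W).τ₃
    rw [← (d.muHom S W).comm₂₃] at this
    exact epi_of_epi (d.muHom S W).τ₂ _
  exact isIso₁_of_shortExact_of_isIso₂₃ (d.muHom S W) h₁ h₂ i₂ i₃

end RDuality

/-! ### Partial closures of braids -/

section Closure

variable {C : Type u} [Category.{v} C] [MonoidalCategory C] {X Y : C}
  (i : 𝟙_ C ⟶ Y ⊗ X) (p : Y ⊗ X ⟶ 𝟙_ C)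

/-- The partial closure of a morphism `X ⊗ A ⟶ X ⊗ B`: its first strand `X` is closed by means of
`i : 𝟙 ⟶ Y ⊗ X` and `p : Y ⊗ X ⟶ 𝟙`. No triangle identity is assumed. -/
def partialClosure {A B : C} (g : X ⊗ A ⟶ X ⊗ B) : A ⟶ B :=
  (λ_ A).inv ≫ i ▷ A ≫ (α_ Y X A).hom ≫ Y ◁ g ≫ (α_ Y X B).inv ≫ p ▷ B ≫ (λ_ B).hom

lemma partialClosure_id (h : i ≫ p = 𝟙 _) (A : C) :
    partialClosure i p (𝟙 (X ⊗ A)) = 𝟙 A := by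
  simp [partialClosure, ← comp_whiskerRight_assoc, h]

lemma partialClosure_whiskerLeft_comp {A B D : C} (u : A ⟶ B) (g : X ⊗ B ⟶ X ⊗ D) :
    partialClosure i p (X ◁ u ≫ g) = u ≫ partialClosure i p g := by
  simp only [partialClosure]
  rw [leftUnitor_inv_naturality_assoc, whisker_exchange_assoc]
  simp

lemma partialClosure_comp_whiskerLeft {A B D : C} (g : X ⊗ A ⟶ X ⊗ B) (u : B ⟶ D) :
    partialClosure i p (g ≫ X ◁ u) = partialClosure i p g ≫ u := by
  simp only [partialClosure, Category.assoc]
  rw [← leftUnitor_naturality, ← whisker_exchange_assoc]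
  simp

variable [BraidedCategory C]

/-- The crossing of the first two strands. -/
def crossing (X A : C) : X ⊗ (X ⊗ A) ≅ X ⊗ (X ⊗ A) :=
  (α_ X X A).symm ≪≫ whiskerRightIso (β_ X X) A ≪≫ α_ X X A

lemma partialClosure_crossing (A : C) :
    partialClosure i p (crossing X A).hom = partialClosure i p (β_ X X).hom ▷ A := by
  simp only [partialClosure, crossing, Iso.trans_hom, Iso.symm_hom, whiskerRightIso_hom]
  monoidal

/-- The conjugate of a morphism by a crossing has the same closure as the morphism itself, with an
unaffected strand added: the whole closed loop is moved across that strand by naturality. -/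
lemma partialClosure_crossing_conj {A B : C} (g : X ⊗ A ⟶ X ⊗ B) :
    partialClosure i p ((crossing X A).hom ≫ X ◁ g ≫ (crossing X B).inv) =
      X ◁ partialClosure i p g := by
  have hi : i ▷ X ⊗≫ Y ◁ (β_ X X).hom =
      𝟙 _ ⊗≫ X ◁ i ⊗≫ (β_ Y X).inv ▷ X ⊗≫ 𝟙 _ := by
    have h := BraidedCategory.braiding_naturality_left i X
    rw [BraidedCategory.braiding_tensor_left_hom, braiding_tensorUnit_left] at h
    calc
      _ = i ▷ X ⊗≫ Y ◁ (β_ X X).hom ⊗≫ ((β_ Y X).hom ≫ (β_ Y X).inv) ▷ X ⊗≫ 𝟙 _ := by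
        rw [Iso.hom_inv_id]; monoidal
      _ = (i ▷ X ≫ (α_ _ _ _).hom ≫ Y ◁ (β_ X X).hom ≫ (α_ _ _ _).inv ≫ (β_ Y X).hom ▷ X ≫
          (α_ _ _ _).hom) ⊗≫ (β_ Y X).inv ▷ X ⊗≫ 𝟙 _ := by monoidal
      _ = _ := by rw [h]; monoidal
  have hp : Y ◁ (β_ X X).inv ⊗≫ p ▷ X = 𝟙 _ ⊗≫ (β_ Y X).hom ▷ X ⊗≫ X ◁ p ⊗≫ 𝟙 _ := by
    have h := BraidedCategory.braiding_naturality_left p X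
    rw [BraidedCategory.braiding_tensor_left_hom, braiding_tensorUnit_left] at h
    calc
      _ = Y ◁ (β_ X X).inv ⊗≫ (p ▷ X ≫ (λ_ X).hom ≫ (ρ_ X).inv) ⊗≫ 𝟙 _ := by monoidal
      _ = Y ◁ ((β_ X X).inv ≫ (β_ X X).hom) ⊗≫ (β_ Y X).hom ▷ X ⊗≫ X ◁ p ⊗≫ 𝟙 _ := by
        rw [h]; monoidal
      _ = _ := by rw [Iso.inv_hom_id]; monoidal
  simp only [partialClosure, crossing, Iso.trans_hom, Iso.symm_hom, whiskerRightIso_hom,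
    Iso.trans_inv, Iso.symm_inv, whiskerRightIso_inv]
  calc
    _ = 𝟙 _ ⊗≫ (i ▷ X ⊗≫ Y ◁ (β_ X X).hom) ▷ A ⊗≫ Y ◁ X ◁ g ⊗≫
        (Y ◁ (β_ X X).inv ⊗≫ p ▷ X) ▷ B ⊗≫ 𝟙 _ := by monoidal
    _ = 𝟙 _ ⊗≫ X ◁ i ▷ A ⊗≫ ((β_ Y X).inv ▷ (X ⊗ A) ≫ (Y ⊗ X) ◁ g) ⊗≫
        (β_ Y X).hom ▷ X ▷ B ⊗≫ X ◁ p ▷ B ⊗≫ 𝟙 _ := by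
      rw [hi, hp]; monoidal
    _ = 𝟙 _ ⊗≫ X ◁ i ▷ A ⊗≫ (X ⊗ Y) ◁ g ⊗≫ ((β_ Y X).inv ≫ (β_ Y X).hom) ▷ (X ⊗ B) ⊗≫
        X ◁ p ▷ B ⊗≫ 𝟙 _ := by
      rw [← whisker_exchange]; monoidal
    _ = _ := by
      rw [Iso.inv_hom_id]; monoidal

/-- Up to unitors, the closure of a crossing is the zigzag of `i ≫ (β_ X Y).inv` and `p`. -/
lemma zigzag_eq_partialClosure :
    (i ≫ (β_ X Y).inv) ▷ X ≫ (α_ X Y X).hom ≫ X ◁ p =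
      (λ_ X).hom ≫ partialClosure i p (β_ X X).hom ≫ (ρ_ X).inv := by
  have h := BraidedCategory.braiding_naturality_right X p
  rw [BraidedCategory.braiding_tensor_right_hom, braiding_tensorUnit_right] at h
  calc
    _ = (i ≫ (β_ X Y).inv) ▷ X ≫ (α_ X Y X).hom ≫ (X ◁ p ≫ (ρ_ X).hom ≫ (λ_ X).inv) ⊗≫ 𝟙 _ := by
      monoidal
    _ = i ▷ X ≫ ((β_ X Y).inv ≫ (β_ X Y).hom) ▷ X ⊗≫ Y ◁ (β_ X X).hom ⊗≫ p ▷ X ⊗≫ 𝟙 _ := by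
      rw [h]; monoidal
    _ = _ := by
      rw [Iso.inv_hom_id]; simp only [partialClosure]; monoidal

/-- The braid on `n + 1` strands which carries the first strand to position `l`, counted from `0`
(or to the last position, if `n < l`), and moves the strands which it crosses one step back. -/
def strandShift (X : C) : (n l : ℕ) → (X ⊗ tensorPow X n ≅ X ⊗ tensorPow X n)
  | _, 0 => Iso.refl _
  | 0, _ + 1 => Iso.refl _
  | n + 1, l + 1 => crossing X (tensorPow X n) ≪≫ whiskerLeftIso X (strandShift X n l)

/-- If the closure of a crossing vanishes, then so does that of `strandShift l` followed by the
inverse of `strandShift k`, for `k < l`. By conjugation, this reduces to the case `k = 0`, in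
which the first position takes part in a single crossing. -/
lemma partialClosure_strandShift [Preadditive C] [MonoidalPreadditive C]
    (h : partialClosure i p (β_ X X).hom = 0) {n k l : ℕ} (hkl : k < l) (hl : l ≤ n) :
    partialClosure i p ((strandShift X n l).hom ≫ (strandShift X n k).inv) = 0 := by
  induction n generalizing k l with
  | zero => omega
  | succ n ih =>
    obtain _ | l := l
    · omega
    obtain _ | k := k
    · have e : partialClosure i p
          ((crossing X (tensorPow X n)).hom ≫ X ◁ (strandShift X n l).hom) = 0 := by
        rw [partialClosure_comp_whiskerLeft, partialClosure_crossing, h,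
          MonoidalPreadditive.zero_whiskerRight, zero_comp]
      exact (congrArg _ (Category.comp_id _)).trans e
    · have e := partialClosure_crossing_conj i p
        ((strandShift X n l).hom ≫ (strandShift X n k).inv)
      rw [ih (Nat.lt_of_succ_lt_succ hkl) (Nat.le_of_succ_le_succ hl),
        MonoidalPreadditive.whiskerLeft_zero, MonoidalCategory.whiskerLeft_comp,
        Category.assoc, ← Category.assoc] at e
      exact e

end Closure

/-! ### Growth of endomorphism spaces -/

section Growth

variable (k : Type w) [Field k] {C : Type u} [Category.{v} C] [Preadditive C] [Linear k C]
  [MonoidalCategory C] [MonoidalPreadditive C] [MonoidalLinear k C] {X Y : C}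

lemma partialClosure_sum {ι : Type*} (s : Finset ι) (i : 𝟙_ C ⟶ Y ⊗ X) (p : Y ⊗ X ⟶ 𝟙_ C)
    {A B : C} (g : ι → (X ⊗ A ⟶ X ⊗ B)) :
    partialClosure i p (∑ l ∈ s, g l) = ∑ l ∈ s, partialClosure i p (g l) := by
  simp [partialClosure, whiskerLeft_sum, Preadditive.comp_sum, Preadditive.sum_comp]

variable [BraidedCategory C]

/-- The linear map `(u₀, …, uₙ) ↦ ∑ (X ⊗ uₗ) ≫ strandShift l`. -/
def shiftSum (X : C) (n : ℕ) :
    (Fin (n + 1) → (tensorPow X n ⟶ tensorPow X n)) →ₗ[k]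
      (X ⊗ tensorPow X n ⟶ X ⊗ tensorPow X n) where
  toFun u := ∑ l : Fin (n + 1), X ◁ u l ≫ (strandShift X n l).hom
  map_add' u u' := by simp [Finset.sum_add_distrib]
  map_smul' r u := by simp [Finset.smul_sum]

/-- The closures of `g ≫ (strandShift k).inv`, for `k = 0, …, n`, recover `(u₀, …, uₙ)` from its
image `g` under `shiftSum`, by a triangular system of equations. -/
lemma shiftSum_injective {i : 𝟙_ C ⟶ Y ⊗ X} {p : Y ⊗ X ⟶ 𝟙_ C} (hip : i ≫ p = 𝟙 _)
    (h : partialClosure i p (β_ X X).hom = 0) (n : ℕ) :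
    Function.Injective (shiftSum k X n) := by
  rw [injective_iff_map_eq_zero]
  intro u hu
  ext m
  induction m using WellFoundedLT.induction with
  | _ m ih =>
    have e : ∑ l : Fin (n + 1), u l ≫ partialClosure i p
        ((strandShift X n l).hom ≫ (strandShift X n m).inv) = 0 := by
      have : partialClosure i p ((shiftSum k X n u) ≫ (strandShift X n m).inv) = 0 := by
        rw [hu, zero_comp]
        simp [partialClosure]
      simpa [shiftSum, Preadditive.sum_comp, partialClosure_sum,
        partialClosure_whiskerLeft_comp] using this
    rw [Finset.sum_eq_single m] at e
    · rwa [Iso.hom_inv_id, partialClosure_id i p hip, Category.comp_id] at e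
    · intro l _ hlm
      rcases lt_or_gt_of_ne hlm with hl | hl
      · rw [ih l hl, Pi.zero_apply, zero_comp]
      · rw [partialClosure_strandShift i p h hl (Nat.le_of_lt_succ l.2), comp_zero]
    · simp

/-- If a crossing of `X` with itself has zero closure, then `End (X^{⊗n})` is at least as large as
the group algebra of the symmetric group. -/
lemma factorial_le_rank [Nontrivial (𝟙_ C ⟶ 𝟙_ C)] {i : 𝟙_ C ⟶ Y ⊗ X} {p : Y ⊗ X ⟶ 𝟙_ C}
    (hip : i ≫ p = 𝟙 _) (h : partialClosure i p (β_ X X).hom = 0) (n : ℕ) :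
    (n.factorial : Cardinal) ≤ Module.rank k (tensorPow X n ⟶ tensorPow X n) := by
  induction n with
  | zero =>
    have : Nontrivial (tensorPow X 0 ⟶ tensorPow X 0) := ‹Nontrivial (𝟙_ C ⟶ 𝟙_ C)›
    rw [Nat.factorial_zero, Nat.cast_one, Cardinal.one_le_iff_pos]
    exact rank_pos
  | succ n ih =>
    calc
      ((n + 1).factorial : Cardinal) = (n + 1 : ℕ) * n.factorial := by
        rw [Nat.factorial_succ, Nat.cast_mul]
      _ ≤ (n + 1 : ℕ) * Module.rank k (tensorPow X n ⟶ tensorPow X n) := by gcongr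
      _ = Module.rank k (Fin (n + 1) → (tensorPow X n ⟶ tensorPow X n)) := by
        rw [rank_pi, Cardinal.sum_const]; simp
      _ ≤ _ := LinearMap.rank_le_of_injective _ (shiftSum_injective k hip h n)

end Growth

section NonNegligible

variable (k : Type w) [Field k] {C : Type u} [Category.{v} C] [Abelian C] [Linear k C]
  [MonoidalCategory C] [MonoidalPreadditive C] [MonoidalLinear k C] [BraidedCategory C]

/-- A non-negligible simple object of moderate growth is rigid. -/
lemma RDuality.hasRightDual_of_nonNegligible (d : RDuality C) [Simple (𝟙_ C)] (X : C) [Simple X]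
    (hX : NonNegligible X) (hgrowth : ModerateGrowthObj k X) : Nonempty (HasRightDual X) := by
  obtain ⟨-, Y, Z, ⟨e⟩⟩ := hX
  let i : 𝟙_ C ⟶ Y ⊗ X := biprod.inl ≫ e.inv
  let p : Y ⊗ X ⟶ 𝟙_ C := e.hom ≫ biprod.fst
  have hip : i ≫ p = 𝟙 _ := by simp [i, p]
  by_cases h : partialClosure i p (β_ X X).hom = 0
  · obtain ⟨n, hn⟩ := hgrowth
    have : Nontrivial (𝟙_ C ⟶ 𝟙_ C) := ⟨𝟙 _, 0, id_nonzero _⟩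
    exact absurd hn (factorial_le_rank k hip h n).not_gt
  · have := isIso_of_hom_simple h
    refine d.nonempty_hasRightDual_of_isIso (i ≫ (β_ X Y).inv) p ?_
    rw [zigzag_eq_partialClosure]
    infer_instance

end NonNegligible

/-! ### Rigidity and composition series -/

section CompositionSeries

variable {C : Type u} [Category.{v} C] [Abelian C] [MonoidalCategory C] [MonoidalPreadditive C]
  [BraidedCategory C]

/-- The classes of the rigid simple objects. -/
def rigidClasses (C : Type u) [Category.{v} C] [Abelian C] [MonoidalCategory C] : Set (Irr C) :=
  {x | ∀ (X : C) [Simple X], Irr.mk X = x → Nonempty (HasRightDual X)}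

lemma RDuality.hasRightDual_of_compositionSeries (d : RDuality C) {X : C} {m : Multiset (Irr C)}
    (h : HasCompositionSeries X m) (hm : ∀ s ∈ m, s ∈ rigidClasses C) :
    Nonempty (HasRightDual X) := by
  induction h with
  | zero X hX =>
    refine d.nonempty_hasRightDual_of_isIso (Y := X) 0 0 ?_
    have h₁ : IsZero (𝟙_ C ⊗ X) := hX.of_iso (λ_ X)
    exact ⟨0, h₁.eq_of_src _ _, (hX.of_iso (ρ_ X)).eq_of_src _ _⟩
  | extend E hE m h ih =>
    have := (ih fun s hs => hm s (Multiset.mem_cons_of_mem hs)).some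
    have := (hm _ (Multiset.mem_cons_self _ _) E.X₃ rfl).some
    exact d.hasRightDual_X₂ hE

/-- If all composition factors of a rigid object but one are rigid, then so is the last one. -/
lemma RDuality.mem_rigidClasses_of_compositionSeries (d : RDuality C) {X : C}
    {M : Multiset (Irr C)} (h : HasCompositionSeries X M) (hX : Nonempty (HasRightDual X))
    {x : Irr C} {m : Multiset (Irr C)} (hM : M = x ::ₘ m) (hm : ∀ s ∈ m, s ∈ rigidClasses C) :
    x ∈ rigidClasses C := by
  induction h generalizing m with
  | zero X _ => exact absurd hM (Multiset.zero_ne_cons)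
  | extend E hE M h ih =>
    have := hX.some
    rcases Multiset.cons_eq_cons.1 hM with ⟨rfl, rfl⟩ | ⟨-, m', rfl, rfl⟩
    · have := (d.hasRightDual_of_compositionSeries h hm).some
      have := (d.hasRightDual_X₃ hE).some
      intro X _ hX
      obtain ⟨e⟩ := Quotient.exact hX
      have := exactPairingCongrLeft (Y := E.X₃ᘁ) e
      exact ⟨{ rightDual := E.X₃ᘁ }⟩
    · have := (hm _ (Multiset.mem_cons_self _ _) E.X₃ rfl).some
      exact ih (d.hasRightDual_X₁ hE) rfl fun s hs => hm s (Multiset.mem_cons_of_mem hs)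

lemma hasRightDual_tensorList {C : Type u} [Category.{v} C] [MonoidalCategory C] (Xs : List C)
    (h : ∀ Y ∈ Xs, Nonempty (HasRightDual Y)) : Nonempty (HasRightDual (tensorList Xs)) := by
  induction Xs with
  | nil => exact ⟨hasRightDualUnit⟩
  | cons X Xs ih =>
    have := (h X List.mem_cons_self).some
    have := (ih fun Y hY => h Y (List.mem_cons_of_mem X hY)).some
    exact ⟨hasRightDualTensor (X := X) (Y := tensorList Xs)⟩

end CompositionSeries

end BraidedRigidity

open BraidedRigidity in
theorem theorem4p12
    {k : Type*} [Field k] [IsAlgClosed k]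
    {C : Type*} [Category C] [Abelian C] [Linear k C]
    [MonoidalCategory C] [MonoidalPreadditive C] [MonoidalLinear k C] [BraidedCategory C]
    (hC : BraidedRigidity.IsSemiRigid C)
    (hgrowth : BraidedRigidity.ModerateGrowth k C)
    (S : Set (BraidedRigidity.Irr C))
    (hS : ∀ (X : C) [Simple X], BraidedRigidity.Irr.mk X ∈ S → BraidedRigidity.NonNegligible X)
    (F : ℕ → Set (BraidedRigidity.Irr C))
    (hF : BraidedRigidity.IsRecursiveFiltration S F) :
    Nonempty (RigidCategory C) := by
  obtain ⟨⟨d⟩, hlength, _⟩ := hC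
  have hS' (x : Irr C) (hx : x ∈ S) : x ∈ rigidClasses C := by
    rintro X _ rfl
    have := hS X hx
    exact d.hasRightDual_of_nonNegligible k X this (hgrowth X this.1)
  have hprev (n : ℕ) (hn : ∀ x ∈ prevStep F n, x ∈ rigidClasses C) (x : Irr C) (hx : x ∈ F n) :
      x ∈ rigidClasses C := by
    obtain ⟨Xs, hXs, m, hm, hmF⟩ := hF.recursive n x hx
    refine d.mem_rigidClasses_of_compositionSeries hm (hasRightDual_tensorList Xs fun Y hY => ?_)
      rfl fun y hy => hn y (hmF y hy)
    obtain ⟨m', hm', hmS⟩ := hXs Y hY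
    exact d.hasRightDual_of_compositionSeries hm' fun s hs => hS' s (hmS s hs)
  have hstep (n : ℕ) : ∀ x ∈ F n, x ∈ rigidClasses C := by
    induction n with
    | zero => exact hprev 0 fun x hx => hx.elim
    | succ n ih => exact hprev (n + 1) ih
  have hall (X : C) : Nonempty (HasRightDual X) := by
    obtain ⟨m, hm⟩ := hlength X
    refine d.hasRightDual_of_compositionSeries hm fun s _ => ?_
    obtain ⟨n, hn⟩ := hF.exhaustive s
    exact hstep n s hn
  have : RightRigidCategory C := { rightDual := fun X => (hall X).some }
  exact ⟨BraidedCategory.rigidCategoryOfRightRigidCategory⟩
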